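/- Let $d,M\ge 1$, $\mathcal X=\mathbb R^d$ with its Borel $\sigma$-field, $\mathcal Y=\{1,\dots,M\}$ with its power set, and let $\mathcal P(\mathcal X\times\mathcal Y)$ be the set of probability measures on $\mathcal X\times\mathcal Y$. Let $\mathcal Q(\mathcal X)$ be the set of finite partitions $\pi=\{A_1,\dots,A_K\}$ of $\mathcal X$ into nonempty Borel sets. For each $\pi\in\mathcal Q(\mathcal X)$ fix points $\hat x_i\in A_i$ and let $\eta_\pi(x)=\sum_{i=1}^K \mathbf 1_{A_i}(x)\,\hat x_i$ be the associated vector quantizer. For random variables $U$ and $Y\in\mathcal Y$ put $I(U;Y)=H(Y)-H(Y|U)$, where $H(Y)=-\sum_{y}P(Y=y)\log P(Y=y)$ and $H(Y|U)=\int \bigl(-\sum_y P(Y=y|U=u)\log P(Y=y|U=u)\bigr)\,dP_U(u)$. For $(X,Y)\sim\mu\in\mathcal P(\mathcal X\times\mathcal Y)$ and $U=\eta_\pi(X)$ let $I(X;Y|\eta_\pi(X))=\int I_u(X;Y)\,dP_U(u)$, where $I_u(X;Y)$ is the mutual information of $X$ and $Y$ under the conditional law of $(X,Y)$ given $U=u$.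 Let $$\mathcal P_\pi(\mathcal X\times\mathcal Y)=\{\mu\in\mathcal P(\mathcal X\times\mathcal Y): I(X;Y)=I(\eta_\pi(X);Y)\text{ for }(X,Y)\sim\mu\},$$ and let $D(\cdot\|\cdot)$ be the Kullback--Leibler divergence. Then $$\max_{\mu\in\mathcal P(\mathcal X\times\mathcal Y)}\ \inf_{\tilde\mu\in\bigcup_{\pi\in\mathcal Q(\mathcal X)}\mathcal P_\pi(\mathcal X\times\mathcal Y)} D(\mu\|\tilde\mu)=0 ,$$ that is, the infimum is $0$ for every $\mu$. Moreover, for every $\mu\in\mathcal P(\mathcal X\times\mathcal Y)$ and $(X,Y)\sim\mu$, $$\inf_{\pi\in\mathcal Q(\mathcal X)} I(X;Y|\eta_\pi(X))=0 .$$ -/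

import Mathlib

open MeasureTheory ProbabilityTheory InformationTheory

noncomputable section

/-- The observation space `ℝ^d` with its Borel σ-field. -/
abbrev ObsSpace (d : ℕ) : Type := EuclideanSpace ℝ (Fin d)

/-- Shannon entropy `-∑ y, ν(y) log ν(y)` of a measure on the finite label set (`0 log 0 = 0`). -/
def shannonEntropy {M : ℕ} (ν : Measure (Fin M)) : ℝ :=
  ∑ y, Real.negMulLog (ν.real {y})

/-- Conditional entropy `H(Y|U) = ∫ H(ρ_{Y|U}(·|u)) dρ_U(u)`, where `ρ` is the law of `(U, Y)`. -/
def condEntropy {U : Type*} [MeasurableSpace U] {M : ℕ} [NeZero M]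
    (ρ : Measure (U × Fin M)) [IsFiniteMeasure ρ] : ℝ :=
  ∫ u, shannonEntropy (ρ.condKernel u) ∂ρ.fst

/-- Mutual information `I(U;Y) = H(Y) - H(Y|U)`, where `ρ` is the law of `(U, Y)`. -/
def mutualInfo {U : Type*} [MeasurableSpace U] {M : ℕ} [NeZero M]
    (ρ : Measure (U × Fin M)) [IsFiniteMeasure ρ] : ℝ :=
  shannonEntropy ρ.snd - condEntropy ρ

/-- The law of `(η(X), Y)` when `(X, Y)` has law `μ`. -/
def encodedLaw {d M : ℕ} {U : Type*} [MeasurableSpace U] (η : ObsSpace d → U)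
    (μ : ProbabilityMeasure (ObsSpace d × Fin M)) : Measure (U × Fin M) :=
  (μ : Measure (ObsSpace d × Fin M)).map (fun p => (η p.1, p.2))

instance {d M : ℕ} {U : Type*} [MeasurableSpace U] (η : ObsSpace d → U)
    (μ : ProbabilityMeasure (ObsSpace d × Fin M)) : IsFiniteMeasure (encodedLaw η μ) := by
  unfold encodedLaw; infer_instance

/-- The class of models for which the encoder `η` is information sufficient:
`I(X;Y) = I(η(X);Y)`. -/
def ISClass {d M : ℕ} [NeZero M] {U : Type*} [MeasurableSpace U] (η : ObsSpace d → U) :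
    Set (ProbabilityMeasure (ObsSpace d × Fin M)) :=
  {μ | mutualInfo (μ : Measure (ObsSpace d × Fin M)) = mutualInfo (encodedLaw η μ)}

/-- Conditional mutual information `I(X;Y|U) = ∫ I(μ_{X,Y|U}(·|u)) dμ_U(u)` with `U = η(X)`;
`μ_{X,Y|U}` is the regular conditional law of `(X, Y)` given `U`. -/
def condMutualInfo {d M : ℕ} [NeZero M] {U : Type*} [MeasurableSpace U] (η : ObsSpace d → U)
    (μ : ProbabilityMeasure (ObsSpace d × Fin M)) : ℝ :=
  ∫ u, mutualInfo (condDistrib (fun p : ObsSpace d × Fin M => p) (fun p => η p.1)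
      (μ : Measure (ObsSpace d × Fin M)) u)
    ∂((μ : Measure (ObsSpace d × Fin M)).map (fun p => η p.1))

/-- A finite measurable partition of `ℝ^d` into `size` nonempty cells. -/
structure FinMeasPartition (d : ℕ) where
  size : ℕ
  cell : Fin size → Set (ObsSpace d)
  measurableSet_cell : ∀ i, MeasurableSet (cell i)
  nonempty_cell : ∀ i, (cell i).Nonempty
  disjoint_cell : Pairwise fun i j => Disjoint (cell i) (cell j)
  iUnion_cell : ⋃ i, cell i = Set.univ

/-- The vector quantizer `x ↦ ∑ i, 1_{A_i}(x) • x̂_i` of a partition `π = {A_i}` with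
reproduction points `x̂_i`. -/
def vectorQuantizer {d : ℕ} (π : FinMeasPartition d) (rep : Fin π.size → ObsSpace d)
    (x : ObsSpace d) : ObsSpace d :=
  ∑ i, (π.cell i).indicator (fun _ => rep i) x

end

/-!
A measurable map with totally bounded range is uniformly approximated by its values at the
quantized points, because cells on which it has small oscillation are the fibers of the map sending
`x` to the set of balls of a finite net that contain its value. Applied to the posterior
`x ↦ P(Y = · | X = x)`, this gives a quantizer `η` for which the posteriors at `x` and at `η x`,
as well as at any two points of one cell, differ by at most `δ` in every label.

* Let `ν` have the input marginal of `μ` and, as posterior at `x`, the posterior at `η x` smoothed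
  by `δ` times the counting measure. Its posterior is a function of `η x`, so `η` is information
  sufficient for `ν`, and `μ ≤ (1 + M δ) • ν` gives `D(μ‖ν) ≤ log (1 + M δ) ≤ M δ`.
* On each cell of `η` a label has posterior `p ≤ q + δ`, where `q` is the mean of `p` over the
  cell. Integrating `p log p ≤ p log (q + δ)` and using `q log (q + δ) ≤ q log q + δ` bounds the
  mutual information given the cell by `M δ`.
-/

section KullbackLeibler

lemma klFun_le_of_le {x c : ℝ} (hx : 0 ≤ x) (hxc : x ≤ c) :
    klFun x ≤ (Real.log c - 1) * x + 1 := by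
  have hlog : x * Real.log x ≤ x * Real.log c := by
    rcases hx.eq_or_lt with rfl | hx
    · simp
    · gcongr
  rw [klFun_apply]
  linarith

variable {Ω : Type*} [MeasurableSpace Ω]

lemma klDiv_le_log_of_le_smul {μ ν : Measure Ω} [IsProbabilityMeasure μ] [IsProbabilityMeasure ν]
    {c : ENNReal} (hc : c ≠ ⊤) (h : μ ≤ c • ν) :
    klDiv μ ν ≤ ENNReal.ofReal (Real.log c.toReal) := by
  have hac : μ ≪ ν := Measure.absolutelyContinuous_of_le_smul h
  have hrn : ∀ᵐ x ∂ν, μ.rnDeriv ν x ≤ c :=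
    ae_le_of_forall_setLIntegral_le_of_sigmaFinite (Measure.measurable_rnDeriv μ ν)
      fun s _ _ ↦ (Measure.setLIntegral_rnDeriv_le s).trans (by simpa using h s)
  have hkl : ∀ᵐ x ∂ν, klFun (μ.rnDeriv ν x).toReal ≤
      (Real.log c.toReal - 1) * (μ.rnDeriv ν x).toReal + 1 :=
    hrn.mono fun x hx ↦ klFun_le_of_le ENNReal.toReal_nonneg (ENNReal.toReal_mono hc hx)
  have hint : Integrable (fun x ↦ (Real.log c.toReal - 1) * (μ.rnDeriv ν x).toReal) ν :=
    Measure.integrable_toReal_rnDeriv.const_mul _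
  calc klDiv μ ν = ∫⁻ x, ENNReal.ofReal (klFun (μ.rnDeriv ν x).toReal) ∂ν :=
        klDiv_eq_lintegral_klFun_of_ac hac
    _ ≤ ∫⁻ x, ENNReal.ofReal ((Real.log c.toReal - 1) * (μ.rnDeriv ν x).toReal + 1) ∂ν :=
        lintegral_mono_ae (hkl.mono fun x hx ↦ ENNReal.ofReal_le_ofReal hx)
    _ = ENNReal.ofReal (∫ x, ((Real.log c.toReal - 1) * (μ.rnDeriv ν x).toReal + 1) ∂ν) :=
        (ofReal_integral_eq_lintegral_ofReal (hint.add (integrable_const 1))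
          (hkl.mono fun x hx ↦ (klFun_nonneg ENNReal.toReal_nonneg).trans hx)).symm
    _ = ENNReal.ofReal (Real.log c.toReal) := by
        rw [integral_add hint (integrable_const 1), integral_const_mul,
          Measure.integral_toReal_rnDeriv hac]
        simp

end KullbackLeibler

section Kernels

variable {U V W : Type*} [MeasurableSpace U] [MeasurableSpace V] [MeasurableSpace W]

lemma compProd_le_smul_compProd (m : Measure U) [SFinite m] {κ κ' : Kernel U V}
    [IsSFiniteKernel κ] [IsSFiniteKernel κ'] {c : ENNReal} (h : ∀ x, κ x ≤ c • κ' x) :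
    m ⊗ₘ κ ≤ c • (m ⊗ₘ κ') := by
  refine Measure.le_iff.2 fun s hs ↦ ?_
  rw [Measure.smul_apply, Measure.compProd_apply hs, Measure.compProd_apply hs, smul_eq_mul,
    ← lintegral_const_mul _ (Kernel.measurable_kernel_prodMk_left hs)]
  exact lintegral_mono fun x ↦ h x _

lemma map_compProd_comap (m : Measure U) [SFinite m] (κ : Kernel W V) [IsSFiniteKernel κ]
    {η : U → W} (hη : Measurable η) :
    (m ⊗ₘ κ.comap η hη).map (Prod.map η id) = m.map η ⊗ₘ κ := by
  have hmap : Measurable (Prod.map η (id : V → V)) := hη.prodMap measurable_id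
  ext s hs
  rw [Measure.map_apply hmap hs, Measure.compProd_apply (hmap hs), Measure.compProd_apply hs,
    lintegral_map (Kernel.measurable_kernel_prodMk_left hs) hη]
  rfl

lemma cond_compProd (m : Measure U) [SFinite m] (κ : Kernel U V) [IsMarkovKernel κ] {A : Set U}
    (hA : MeasurableSet A) : m[|A] ⊗ₘ κ = (m ⊗ₘ κ)[|Prod.fst ⁻¹' A] := by
  have hmass : (m ⊗ₘ κ) (Prod.fst ⁻¹' A) = m A := by
    rw [← Measure.fst_apply hA, Measure.fst_compProd]
  have hrestrict : m.restrict A ⊗ₘ κ = (m ⊗ₘ κ).restrict (Prod.fst ⁻¹' A) := by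
    ext s hs
    rw [Measure.restrict_apply hs, Measure.compProd_apply hs,
      Measure.compProd_apply (hs.inter (measurable_fst hA)), ← lintegral_indicator hA]
    refine lintegral_congr fun x ↦ ?_
    by_cases hx : x ∈ A <;> simp [hx, Set.preimage_preimage]
  rw [ProbabilityTheory.cond, ProbabilityTheory.cond, Measure.compProd_smul_left, hmass, hrestrict]

lemma snd_compProd_real (m : Measure U) [SFinite m] (κ : Kernel U V) [IsFiniteKernel κ]
    {s : Set V} (hs : MeasurableSet s) : (m ⊗ₘ κ).snd.real s = ∫ x, (κ x).real s ∂m := by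
  rw [Measure.real, Measure.snd_compProd, Measure.bind_apply hs κ.aemeasurable]
  exact (integral_toReal (κ.measurable_coe hs).aemeasurable
    (ae_of_all _ fun x ↦ measure_lt_top _ _)).symm

/-- The additive smoothing of a kernel by a measure `ρ`: the mixture of `κ x` and `ρ`, normalised
on the assumption that `κ` is Markov. A measure exceeding `κ x` by at most `ρ` is dominated by
`1 + ρ Set.univ` times the smoothed value at `x`. -/
noncomputable def smoothedKernel (κ : Kernel U V) (ρ : Measure V) : Kernel U V where
  toFun x := (1 + ρ Set.univ)⁻¹ • (κ x + ρ)
  measurable' := Measure.measurable_of_measurable_coe _ fun _ hs ↦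
    ((κ.measurable_coe hs).add_const _).const_mul _

lemma smoothedKernel_apply (κ : Kernel U V) (ρ : Measure V) (x : U) :
    smoothedKernel κ ρ x = (1 + ρ Set.univ)⁻¹ • (κ x + ρ) := rfl

instance (κ : Kernel U V) [IsMarkovKernel κ] (ρ : Measure V) [IsFiniteMeasure ρ] :
    IsMarkovKernel (smoothedKernel κ ρ) where
  isProbabilityMeasure x := ⟨by
    rw [smoothedKernel_apply, Measure.smul_apply, Measure.add_apply,
      measure_univ (μ := κ x), smul_eq_mul, ENNReal.inv_mul_cancel (by simp) (by simp)]⟩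

lemma smul_smoothedKernel_apply (κ : Kernel U V) (ρ : Measure V) [IsFiniteMeasure ρ] (x : U) :
    (1 + ρ Set.univ) • smoothedKernel κ ρ x = κ x + ρ := by
  rw [smoothedKernel_apply, smul_smul, ENNReal.mul_inv_cancel (by simp) (by simp), one_smul]

lemma klDiv_compProd_smoothedKernel_le (m : Measure U) [IsProbabilityMeasure m]
    {κ : Kernel U V} [IsMarkovKernel κ] {κ' : Kernel W V} [IsMarkovKernel κ'] {η : U → W}
    (hη : Measurable η) {ρ : Measure V} [IsFiniteMeasure ρ] (h : ∀ x, κ x ≤ κ' (η x) + ρ) :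
    klDiv (m ⊗ₘ κ) (m ⊗ₘ (smoothedKernel κ' ρ).comap η hη) ≤ ρ Set.univ := by
  have hle : m ⊗ₘ κ ≤ (1 + ρ Set.univ) • (m ⊗ₘ (smoothedKernel κ' ρ).comap η hη) :=
    compProd_le_smul_compProd m fun x ↦ by
      rw [Kernel.comap_apply, smul_smoothedKernel_apply]
      exact h x
  calc klDiv (m ⊗ₘ κ) (m ⊗ₘ (smoothedKernel κ' ρ).comap η hη)
      ≤ ENNReal.ofReal (Real.log (1 + ρ Set.univ).toReal) :=
        klDiv_le_log_of_le_smul (by simp) hle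
    _ ≤ ENNReal.ofReal ((1 + ρ Set.univ).toReal - 1) :=
        ENNReal.ofReal_le_ofReal <| Real.log_le_sub_one_of_pos <|
          ENNReal.toReal_pos (by simp) (by simp)
    _ = ρ Set.univ := by
        rw [ENNReal.toReal_add (by simp) (by simp)]
        simp

lemma measure_le_add_smul_count [Finite V] [MeasurableSingletonClass V] {μ ν : Measure V}
    {δ : NNReal} (h : ∀ y, μ {y} ≤ ν {y} + δ) : μ ≤ ν + δ • Measure.count := by
  refine Measure.le_iff.2 fun s _ ↦ ?_
  rw [← s.toFinite.coe_toFinset, ← sum_measure_singleton, ← sum_measure_singleton]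
  exact Finset.sum_le_sum fun y _ ↦ by simpa using h y

end Kernels

section Conditioning

lemma condDistrib_id_apply_of_ne_zero {Ω F : Type*} [MeasurableSpace Ω] [StandardBorelSpace Ω]
    [Nonempty Ω] [MeasurableSpace F] [MeasurableSingletonClass F] {μ : Measure Ω}
    [IsFiniteMeasure μ] {f : Ω → F} (hf : Measurable f) {u : F} (hu : μ.map f {u} ≠ 0) :
    condDistrib (fun ω ↦ ω) f μ u = μ[|f ⁻¹' {u}] := by
  have hu' : MeasurableSet {u} := measurableSet_singleton u
  ext s hs
  rw [condDistrib_apply_of_ne_zero measurable_id' u hu, cond_apply (hf hu'),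
    Measure.map_apply hf hu', Measure.map_apply (hf.prodMk measurable_id') (hu'.prod hs)]
  rfl

lemma ae_map_singleton_ne_zero {Ω F : Type*} [MeasurableSpace Ω] [MeasurableSpace F]
    [MeasurableSingletonClass F] {μ : Measure Ω} {f : Ω → F} (hf : AEMeasurable f μ)
    (hrange : (Set.range f).Countable) : ∀ᵐ u ∂μ.map f, μ.map f {u} ≠ 0 := by
  have hnull : μ.map f {u ∈ Set.range f | μ.map f {u} = 0} = 0 := by
    have hcount : {u ∈ Set.range f | μ.map f {u} = 0}.Countable := hrange.mono fun _ h ↦ h.1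
    rw [← Set.biUnion_of_singleton {u ∈ Set.range f | μ.map f {u} = 0},
      measure_biUnion_null_iff hcount]
    exact fun u hu ↦ hu.2
  have hmem : ∀ᵐ u ∂μ.map f, u ∈ Set.range f :=
    (ae_map_iff hf hrange.measurableSet).2 (ae_of_all _ Set.mem_range_self)
  filter_upwards [hmem, measure_eq_zero_iff_ae_notMem.1 hnull] with u hu hu' h
  exact hu' ⟨hu, h⟩

end Conditioning

section Entropy

lemma mul_log_add_le {t δ : ℝ} (ht : 0 ≤ t) (hδ : 0 ≤ δ) :
    t * Real.log (t + δ) ≤ t * Real.log t + δ := by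
  rcases ht.eq_or_lt with rfl | ht
  · simpa
  · calc t * Real.log (t + δ) = t * Real.log t + t * Real.log ((t + δ) / t) := by
          rw [Real.log_div (by positivity) ht.ne']
          ring
      _ ≤ t * Real.log t + t * ((t + δ) / t - 1) := by
          gcongr
          exact Real.log_le_sub_one_of_pos (by positivity)
      _ = t * Real.log t + δ := by
          field_simp
          ring

variable {U : Type*} [MeasurableSpace U]

lemma negMulLog_integral_le_add {m : Measure U} {f : U → ℝ} {δ : ℝ}
    (hδ : 0 ≤ δ) (hf : Integrable f m) (hlog : Integrable (fun x ↦ Real.negMulLog (f x)) m)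
    (hf₀ : ∀ x, 0 ≤ f x) (hfδ : ∀ᵐ x ∂m, f x ≤ ∫ x', f x' ∂m + δ) :
    Real.negMulLog (∫ x, f x ∂m) ≤ ∫ x, Real.negMulLog (f x) ∂m + δ := by
  have hmean : 0 ≤ ∫ x, f x ∂m := integral_nonneg hf₀
  have hpoint : ∀ᵐ x ∂m,
      -Real.log (∫ x', f x' ∂m + δ) * f x ≤ Real.negMulLog (f x) := by
    filter_upwards [hfδ] with x hx
    rcases (hf₀ x).eq_or_lt with h₀ | h₀
    · simp [← h₀]
    · have := mul_le_mul_of_nonneg_left (Real.log_le_log h₀ hx) h₀.le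
      rw [Real.negMulLog]
      linarith
  have hint := integral_mono_ae (hf.const_mul _) hlog hpoint
  rw [integral_const_mul] at hint
  have := mul_log_add_le hmean hδ
  rw [Real.negMulLog]
  linarith

variable {M : ℕ}

lemma integrable_negMulLog_kernel (m : Measure U) [IsFiniteMeasure m] {V : Type*}
    [MeasurableSpace V] (κ : Kernel U V) [IsMarkovKernel κ] {s : Set V} (hs : MeasurableSet s) :
    Integrable (fun x ↦ Real.negMulLog ((κ x).real s)) m := by
  refine .of_mem_Icc 0 1 (Real.continuous_negMulLog.measurable.comp
    (κ.measurable_coe hs).ennreal_toReal).aemeasurable (ae_of_all _ fun x ↦ ⟨?_, ?_⟩)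
  · exact Real.negMulLog_nonneg measureReal_nonneg measureReal_le_one
  · exact (Real.negMulLog_le_one_sub_self measureReal_nonneg).trans
      (sub_le_self 1 measureReal_nonneg)

variable [NeZero M] {ρ : Measure (U × Fin M)} [IsFiniteMeasure ρ]

lemma condEntropy_eq_integral {m : Measure U} [IsFiniteMeasure m] {κ : Kernel U (Fin M)}
    [IsMarkovKernel κ] (hρ : ρ = m ⊗ₘ κ) : condEntropy ρ = ∫ x, shannonEntropy (κ x) ∂m := by
  have hfst : ρ.fst = m := by rw [hρ, Measure.fst_compProd]
  have hκ := eq_condKernel_of_measure_eq_compProd κ (hfst.symm ▸ hρ)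
  rw [hfst] at hκ
  rw [condEntropy, hfst]
  exact integral_congr_ae (hκ.mono fun x hx ↦ by simp only [hx])

lemma mutualInfo_eq_sum {m : Measure U} [IsFiniteMeasure m] {κ : Kernel U (Fin M)}
    [IsMarkovKernel κ] (hρ : ρ = m ⊗ₘ κ) :
    mutualInfo ρ = ∑ y, (Real.negMulLog (∫ x, (κ x).real {y} ∂m) -
      ∫ x, Real.negMulLog ((κ x).real {y}) ∂m) := by
  rw [mutualInfo, condEntropy_eq_integral hρ, hρ]
  simp only [shannonEntropy, snd_compProd_real m κ (measurableSet_singleton _)]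
  rw [integral_finsetSum _ fun y _ ↦ integrable_negMulLog_kernel m κ (measurableSet_singleton y),
    Finset.sum_sub_distrib]

lemma mutualInfo_nonneg (ρ : Measure (U × Fin M)) [IsProbabilityMeasure ρ] :
    0 ≤ mutualInfo ρ := by
  rw [mutualInfo_eq_sum (ρ.disintegrate ρ.condKernel).symm]
  refine Finset.sum_nonneg fun y _ ↦ sub_nonneg.2 ?_
  exact Real.concaveOn_negMulLog.le_map_integral Real.continuous_negMulLog.continuousOn
    isClosed_Ici (ae_of_all _ fun x ↦ measureReal_nonneg)
    (Kernel.IsMarkovKernel.integrable _ _ (measurableSet_singleton y))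
    (integrable_negMulLog_kernel _ _ (measurableSet_singleton y))

lemma mutualInfo_le_of_oscillation_le {m : Measure U} [IsProbabilityMeasure m]
    {κ : Kernel U (Fin M)} [IsMarkovKernel κ] (hρ : ρ = m ⊗ₘ κ) {A : Set U}
    (hA : ∀ᵐ x ∂m, x ∈ A) {δ : ℝ} (hδ : 0 ≤ δ)
    (hκ : ∀ x ∈ A, ∀ x' ∈ A, ∀ y, (κ x).real {y} ≤ (κ x').real {y} + δ) :
    mutualInfo ρ ≤ M * δ := by
  have hint (y : Fin M) : Integrable (fun x ↦ (κ x).real {y}) m :=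
    Kernel.IsMarkovKernel.integrable m κ (measurableSet_singleton y)
  have hmean (y : Fin M) : ∀ᵐ x ∂m, (κ x).real {y} ≤ ∫ x', (κ x').real {y} ∂m + δ := by
    filter_upwards [hA] with x hx
    have := integral_mono_ae (integrable_const ((κ x).real {y} - δ)) (hint y)
      (hA.mono fun x' hx' ↦ sub_le_iff_le_add.2 (hκ x hx x' hx' y))
    rw [integral_const, probReal_univ, one_smul] at this
    linarith
  rw [mutualInfo_eq_sum hρ]
  calc _ ≤ ∑ _y : Fin M, δ := Finset.sum_le_sum fun y _ ↦ sub_le_iff_le_add'.2 <|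
        negMulLog_integral_le_add hδ (hint y)
          (integrable_negMulLog_kernel m κ (measurableSet_singleton y))
          (fun _ ↦ measureReal_nonneg) (hmean y)
    _ = M * δ := by simp

end Entropy

section Encoders

variable {d M : ℕ} [NeZero M] {U : Type*} [MeasurableSpace U] {η : ObsSpace d → U}

lemma mem_ISClass_of_eq_compProd_comap (hη : Measurable η)
    {ν : ProbabilityMeasure (ObsSpace d × Fin M)} {m : Measure (ObsSpace d)}
    [IsFiniteMeasure m] {κ : Kernel U (Fin M)} [IsMarkovKernel κ]
    (hν : (ν : Measure (ObsSpace d × Fin M)) = m ⊗ₘ κ.comap η hη) : ν ∈ ISClass η := by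
  have henc : encodedLaw η ν = m.map η ⊗ₘ κ := by
    rw [← map_compProd_comap m κ hη, ← hν]
    rfl
  have hmeas (y : Fin M) : Measurable fun u ↦ (κ u).real {y} :=
    (κ.measurable_coe (measurableSet_singleton y)).ennreal_toReal
  change mutualInfo _ = mutualInfo _
  rw [mutualInfo_eq_sum hν, mutualInfo_eq_sum henc]
  refine Finset.sum_congr rfl fun y _ ↦ ?_
  have hmeas' : Measurable fun u ↦ Real.negMulLog ((κ u).real {y}) :=
    Real.continuous_negMulLog.measurable.comp (hmeas y)
  rw [integral_map hη.aemeasurable (hmeas y).aestronglyMeasurable,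
    integral_map hη.aemeasurable hmeas'.aestronglyMeasurable]
  rfl

lemma exists_mem_ISClass_klDiv_le {η : ObsSpace d → ObsSpace d} (hη : Measurable η)
    (μ : ProbabilityMeasure (ObsSpace d × Fin M)) {δ : NNReal}
    (h : ∀ x y, ((μ : Measure (ObsSpace d × Fin M)).condKernel x).real {y} ≤
      ((μ : Measure (ObsSpace d × Fin M)).condKernel (η x)).real {y} + δ) :
    ∃ ν ∈ (ISClass η : Set (ProbabilityMeasure (ObsSpace d × Fin M))),
      klDiv (μ : Measure (ObsSpace d × Fin M)) (ν : Measure (ObsSpace d × Fin M)) ≤ M * δ := by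
  let m := (μ : Measure (ObsSpace d × Fin M)).fst
  let κ := (μ : Measure (ObsSpace d × Fin M)).condKernel
  let ρ : Measure (Fin M) := δ • Measure.count
  have hκ (x : ObsSpace d) : κ x ≤ κ (η x) + ρ := by
    refine measure_le_add_smul_count fun y ↦ ?_
    rw [← ofReal_measureReal, ← ofReal_measureReal, ← ENNReal.ofReal_coe_nnreal,
      ← ENNReal.ofReal_add measureReal_nonneg δ.coe_nonneg]
    exact ENNReal.ofReal_le_ofReal (h x y)
  have hμ : m ⊗ₘ κ = μ := Measure.disintegrate _ _
  refine ⟨⟨m ⊗ₘ (smoothedKernel κ ρ).comap η hη, inferInstance⟩,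
    mem_ISClass_of_eq_compProd_comap hη rfl, ?_⟩
  calc _ = klDiv (m ⊗ₘ κ) (m ⊗ₘ (smoothedKernel κ ρ).comap η hη) := by rw [hμ]; rfl
    _ ≤ ρ Set.univ := klDiv_compProd_smoothedKernel_le m hη hκ
    _ = M * δ := by rw [Measure.coe_nnreal_smul_apply]; simp [mul_comm]

lemma condMutualInfo_nonneg (η : ObsSpace d → U)
    (μ : ProbabilityMeasure (ObsSpace d × Fin M)) : 0 ≤ condMutualInfo η μ :=
  integral_nonneg fun _ ↦ mutualInfo_nonneg _

lemma condMutualInfo_le_of_oscillation_le [MeasurableSingletonClass U] (hη : Measurable η)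
    (hrange : (Set.range η).Countable) (μ : ProbabilityMeasure (ObsSpace d × Fin M)) {δ : ℝ}
    (hδ : 0 ≤ δ)
    (h : ∀ x x', η x = η x' → ∀ y, ((μ : Measure (ObsSpace d × Fin M)).condKernel x).real {y} ≤
      ((μ : Measure (ObsSpace d × Fin M)).condKernel x').real {y} + δ) :
    condMutualInfo η μ ≤ M * δ := by
  set P : Measure (ObsSpace d × Fin M) := (μ : Measure (ObsSpace d × Fin M))
  have hη' : Measurable fun p : ObsSpace d × Fin M ↦ η p.1 := hη.comp measurable_fst
  have hrange' : (Set.range fun p : ObsSpace d × Fin M ↦ η p.1).Countable :=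
    hrange.mono (Set.range_comp_subset_range Prod.fst η)
  have := Measure.isProbabilityMeasure_map (μ := P) hη'.aemeasurable
  have hatom : ∀ᵐ u ∂P.map fun p ↦ η p.1,
      mutualInfo (condDistrib (fun p ↦ p) (fun p ↦ η p.1) P u) ≤ M * δ := by
    filter_upwards [ae_map_singleton_ne_zero hη'.aemeasurable hrange'] with u hu
    have hfib : MeasurableSet (η ⁻¹' {u}) := hη (measurableSet_singleton u)
    have hcond : condDistrib (fun p ↦ p) (fun p ↦ η p.1) P u =
        P.fst[|η ⁻¹' {u}] ⊗ₘ P.condKernel := by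
      rw [condDistrib_id_apply_of_ne_zero hη' hu, cond_compProd _ _ hfib, P.disintegrate]
      rfl
    have hmass : P.fst (η ⁻¹' {u}) ≠ 0 := by
      rw [Measure.map_apply hη' (measurableSet_singleton u)] at hu
      rwa [Measure.fst_apply hfib]
    have := cond_isProbabilityMeasure hmass
    exact mutualInfo_le_of_oscillation_le hcond (ae_cond_mem hfib) hδ
      fun x hx x' hx' ↦ h x x' (hx.trans hx'.symm)
  calc condMutualInfo η μ ≤ ∫ _, M * δ ∂P.map fun p ↦ η p.1 :=
        integral_mono_of_nonneg (ae_of_all _ fun _ ↦ mutualInfo_nonneg _)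
          (integrable_const _) hatom
    _ = M * δ := by simp

end Encoders

section Quantizers

variable {d : ℕ}

lemma FinMeasPartition.exists_mem_cell (π : FinMeasPartition d) (x : ObsSpace d) :
    ∃ i, x ∈ π.cell i :=
  Set.mem_iUnion.1 (π.iUnion_cell ▸ Set.mem_univ x)

lemma vectorQuantizer_of_mem (π : FinMeasPartition d) (rep : Fin π.size → ObsSpace d)
    {i : Fin π.size} {x : ObsSpace d} (hx : x ∈ π.cell i) :
    vectorQuantizer π rep x = rep i := by
  rw [vectorQuantizer, Finset.sum_eq_single i, Set.indicator_of_mem hx]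
  · exact fun j _ hj ↦
      Set.indicator_of_notMem (Set.disjoint_left.1 (π.disjoint_cell hj.symm) hx) _
  · simp

lemma measurable_vectorQuantizer (π : FinMeasPartition d) (rep : Fin π.size → ObsSpace d) :
    Measurable (vectorQuantizer π rep) :=
  Finset.measurable_fun_sum _ fun i _ ↦ measurable_const.indicator (π.measurableSet_cell i)

lemma finite_range_vectorQuantizer (π : FinMeasPartition d) (rep : Fin π.size → ObsSpace d) :
    (Set.range (vectorQuantizer π rep)).Finite := by
  refine (Set.finite_range rep).subset (Set.range_subset_iff.2 fun x ↦ ?_)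
  obtain ⟨i, hi⟩ := π.exists_mem_cell x
  exact ⟨i, (vectorQuantizer_of_mem π rep hi).symm⟩

section Fibers

variable {W : Type*} [Finite W] [MeasurableSpace W] [MeasurableSingletonClass W]

/-- The partition of the observation space into the nonempty fibers of a measurable map `g` to a
finite type, indexed by an enumeration of the range of `g` so that no cell is empty. -/
noncomputable def FinMeasPartition.fibers (g : ObsSpace d → W) (hg : Measurable g) :
    FinMeasPartition d where
  size := Nat.card (Set.range g)
  cell i := g ⁻¹' {((Finite.equivFin (Set.range g)).symm i : W)}
  measurableSet_cell _ := hg (measurableSet_singleton _)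
  nonempty_cell i := ((Finite.equivFin (Set.range g)).symm i).2
  disjoint_cell _ _ hij := Disjoint.preimage g <| Set.disjoint_singleton.2 fun h ↦
    hij ((Finite.equivFin (Set.range g)).symm.injective (Subtype.ext h))
  iUnion_cell := Set.eq_univ_of_forall fun x ↦ Set.mem_iUnion.2
    ⟨Finite.equivFin (Set.range g) ⟨g x, x, rfl⟩, by rw [Equiv.symm_apply_apply]; rfl⟩

lemma apply_vectorQuantizer_fibers {g : ObsSpace d → W} (hg : Measurable g)
    {rep : Fin (FinMeasPartition.fibers g hg).size → ObsSpace d}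
    (hrep : ∀ i, rep i ∈ (FinMeasPartition.fibers g hg).cell i) (x : ObsSpace d) :
    g (vectorQuantizer (.fibers g hg) rep x) = g x := by
  obtain ⟨i, hi⟩ := (FinMeasPartition.fibers g hg).exists_mem_cell x
  rw [vectorQuantizer_of_mem _ _ hi]
  exact (hrep i).trans hi.symm

end Fibers

lemma exists_dist_vectorQuantizer_lt {E : Type*} [PseudoMetricSpace E] [MeasurableSpace E]
    [OpensMeasurableSpace E] {f : ObsSpace d → E} (hf : Measurable f)
    (hbdd : TotallyBounded (Set.range f)) {ε : ℝ} (hε : 0 < ε) :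
    ∃ π : FinMeasPartition d, ∀ rep : Fin π.size → ObsSpace d, (∀ i, rep i ∈ π.cell i) →
      ∀ x, dist (f (vectorQuantizer π rep x)) (f x) < ε := by
  obtain ⟨t, ht, hcover⟩ := Metric.totallyBounded_iff.1 hbdd (ε / 2) (half_pos hε)
  have := ht.to_subtype
  let g : ObsSpace d → t → Prop := fun x e ↦ f x ∈ Metric.ball (e : E) (ε / 2)
  have hg : Measurable g := measurable_pi_iff.2 fun _ ↦
    measurableSet_setOfPred.1 (hf measurableSet_ball)
  refine ⟨.fibers g hg, fun rep hrep x ↦ ?_⟩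
  obtain ⟨e, he, hx⟩ := Set.mem_iUnion₂.1 (hcover (Set.mem_range_self x))
  have hqx : f (vectorQuantizer (.fibers g hg) rep x) ∈ Metric.ball e (ε / 2) :=
    (congrFun (apply_vectorQuantizer_fibers hg hrep x) ⟨e, he⟩).mpr hx
  calc _ ≤ _ := dist_triangle_right _ _ e
    _ < ε / 2 + ε / 2 := add_lt_add hqx hx
    _ = ε := add_halves ε

lemma exists_abs_kernel_vectorQuantizer_sub_lt {V : Type*} [Finite V] [MeasurableSpace V]
    [MeasurableSingletonClass V] (κ : Kernel (ObsSpace d) V) [IsMarkovKernel κ] {ε : ℝ}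
    (hε : 0 < ε) :
    ∃ π : FinMeasPartition d, ∀ rep : Fin π.size → ObsSpace d, (∀ i, rep i ∈ π.cell i) →
      ∀ x y, |(κ (vectorQuantizer π rep x)).real {y} - (κ x).real {y}| < ε := by
  have := Fintype.ofFinite V
  let f : ObsSpace d → V → ℝ := fun x y ↦ (κ x).real {y}
  have hf : Measurable f := measurable_pi_iff.2 fun y ↦
    (κ.measurable_coe (measurableSet_singleton y)).ennreal_toReal
  have hbdd : TotallyBounded (Set.range f) := by
    refine (isCompact_Icc (a := (0 : V → ℝ)) (b := 1)).totallyBounded.subset ?_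
    rintro _ ⟨x, rfl⟩
    exact ⟨fun _ ↦ measureReal_nonneg, fun _ ↦ measureReal_le_one⟩
  obtain ⟨π, hπ⟩ := exists_dist_vectorQuantizer_lt hf hbdd hε
  exact ⟨π, fun rep hrep x y ↦ (dist_pi_lt_iff hε).1 (hπ rep hrep x) y⟩

end Quantizers

section Approximation

variable {d M : ℕ} [NeZero M] {rep : (π : FinMeasPartition d) → Fin π.size → ObsSpace d}

lemma iInf_klDiv_ISClass_eq_zero
    (hrep : ∀ (π : FinMeasPartition d) (i : Fin π.size), rep π i ∈ π.cell i)
    (μ : ProbabilityMeasure (ObsSpace d × Fin M)) :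
    ⨅ ν ∈ ⋃ π : FinMeasPartition d, (ISClass (vectorQuantizer π (rep π)) :
        Set (ProbabilityMeasure (ObsSpace d × Fin M))),
      klDiv (μ : Measure (ObsSpace d × Fin M)) (ν : Measure (ObsSpace d × Fin M)) = 0 := by
  refine le_antisymm (ENNReal.le_of_forall_pos_le_add fun ε hε _ ↦ ?_) zero_le
  have hM : (0 : NNReal) < M := by exact_mod_cast Nat.pos_of_neZero M
  obtain ⟨π, hπ⟩ := exists_abs_kernel_vectorQuantizer_sub_lt
    (μ : Measure (ObsSpace d × Fin M)).condKernel (ε := (ε / M : NNReal)) (by positivity)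
  obtain ⟨ν, hν, hkl⟩ := exists_mem_ISClass_klDiv_le (δ := ε / M)
    (measurable_vectorQuantizer π (rep π)) μ
    fun x y ↦ by linarith [(abs_lt.1 (hπ (rep π) (hrep π) x y)).1]
  refine (iInf₂_le ν (Set.mem_iUnion.2 ⟨π, hν⟩)).trans (hkl.trans_eq ?_)
  rw [zero_add]
  exact_mod_cast mul_div_cancel₀ ε hM.ne'

lemma exists_condMutualInfo_vectorQuantizer_le
    (hrep : ∀ (π : FinMeasPartition d) (i : Fin π.size), rep π i ∈ π.cell i)
    (μ : ProbabilityMeasure (ObsSpace d × Fin M)) {ε : ℝ} (hε : 0 < ε) :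
    ∃ π : FinMeasPartition d, condMutualInfo (vectorQuantizer π (rep π)) μ ≤ ε := by
  have hM : (0 : ℝ) < M := by exact_mod_cast Nat.pos_of_neZero M
  obtain ⟨π, hπ⟩ := exists_abs_kernel_vectorQuantizer_sub_lt
    (μ : Measure (ObsSpace d × Fin M)).condKernel (ε := ε / M / 2) (by positivity)
  refine ⟨π, (condMutualInfo_le_of_oscillation_le (measurable_vectorQuantizer π (rep π))
    (finite_range_vectorQuantizer π (rep π)).countable μ (δ := ε / M) (by positivity)
    fun x x' hxx' y ↦ ?_).trans_eq (mul_div_cancel₀ ε hM.ne')⟩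
  have hx := abs_lt.1 (hπ (rep π) (hrep π) x y)
  have hx' := abs_lt.1 (hπ (rep π) (hrep π) x' y)
  rw [hxx'] at hx
  linarith [hx.1, hx'.2]

end Approximation

theorem lemma4 (d M : ℕ) (hd : 0 < d) [NeZero M]
    (rep : (π : FinMeasPartition d) → Fin π.size → ObsSpace d)
    (hrep : ∀ (π : FinMeasPartition d) (i : Fin π.size), rep π i ∈ π.cell i) :
    IsGreatest
      (Set.range fun μ : ProbabilityMeasure (ObsSpace d × Fin M) =>
        ⨅ ν ∈ ⋃ π : FinMeasPartition d,
            (ISClass (vectorQuantizer π (rep π)) :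
              Set (ProbabilityMeasure (ObsSpace d × Fin M))),
          klDiv (μ : Measure (ObsSpace d × Fin M)) (ν : Measure (ObsSpace d × Fin M)))
      0 ∧
    ∀ μ : ProbabilityMeasure (ObsSpace d × Fin M),
      IsGLB
        (Set.range fun π : FinMeasPartition d =>
          condMutualInfo (vectorQuantizer π (rep π)) μ)
        0 := by
  refine ⟨⟨⟨default, iInf_klDiv_ISClass_eq_zero hrep _⟩, ?_⟩, fun μ ↦ ⟨?_, fun b hb ↦ ?_⟩⟩
  · rintro _ ⟨μ, rfl⟩
    exact (iInf_klDiv_ISClass_eq_zero hrep μ).le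
  · rintro _ ⟨π, rfl⟩
    exact condMutualInfo_nonneg _ μ
  · refine le_of_forall_pos_le_add fun ε hε ↦ ?_
    obtain ⟨π, hπ⟩ := exists_condMutualInfo_vectorQuantizer_le hrep μ hε
    exact ((hb ⟨π, rfl⟩).trans hπ).trans_eq (zero_add ε).symm
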